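/- Let $M\ge 2$ and $l\ge 2$ be integers, and let $f_0,\dots,f_{M-1}$ be probability density functions with respect to a common measure on a measurable space $\mathcal X$. Let $\mathbf P_m$ be the probability measure with density $f_m$, let $X$ be an observation with values in $\mathcal X$, and assume $$0<\mathbf E_m\Big[\log\frac{f_m(X)}{f_{m'}(X)}\Big]<\infty\qquad\text{for all } m\ne m'.$$ A deterministic quantizer is a measurable map $\phi:\mathcal X\to\{0,\dots,l-1\}$. A quantizer is a randomization $\bar\phi=\sum_j p^j\phi^j$ which assigns probability masses $p^j\geq 0$, $\sum_j p^j=1$, to a finite or countable set of deterministic quantizers $\phi^j$. For $m\ne m'$ put $$I(m,m';\phi)=\sum_{u=0}^{l-1}\mathbf P_m(\phi(X)=u)\log\frac{\mathbf P_m(\phi(X)=u)}{\mathbf P_{m'}(\phi(X)=u)}\quad\Big(0\log\tfrac00=0\Big),\qquad I(m,m';\bar\phi)=\sum_j p^jI(m,m';\phi^j),$$ and let $I(m;\bar\phi)=\min_{m'\ne m}I(m,m';\bar\phi)$ and $I(m)=\sup_{\bar\phi}I(m;\bar\phi)$, where the supremum is over all quantizers. A quantizer that attains the supremum $I(m)$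 is called a maximin quantizer with respect to $\mathbf P_m$. A deterministic quantizer $\phi$ is an unambiguous likelihood quantizer (ULQ) if there are real numbers $a_{i,m}$ ($0\le i\le l-1$, $0\le m\le M-1$) such that $\phi(x)$ minimizes $i\mapsto\sum_{m=0}^{M-1}a_{i,m}f_m(x)$ over $0\le i\le l-1$ for every $x\in\mathcal X$, and such that the set of $x$ with more than one minimizer has probability zero under every $\mathbf P_m$. **Theorem.** For every $m\in\{0,\dots,M-1\}$, the series defining $I(m,m';\bar\phi)$ converge for all quantizers $\bar\phi$ and all $m'\neq m$, and: 1. there exists a maximin quantizer with respect to $\mathbf P_m$ which is a randomization of at most $M-1$ deterministic quantizers; 2. there exists a sequence of quantizers $(\bar\phi_{m,i})_{i\ge1}$, each a randomization of at most $M-1$ ULQs, such that $I(m;\bar\phi_{m,i})\to I(m)$ as $i\to\infty$. -/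

import Mathlib

open MeasureTheory Filter Topology
open scoped ENNReal

noncomputable section

namespace Decentralized

/-- The law of one raw observation under each hypothesis: the measure with density `g` with
respect to the common underlying measure `ν`. -/
def law {X : Type*} [MeasurableSpace X] (ν : Measure X) (g : X → ℝ) : Measure X :=
  ν.withDensity (fun x => ENNReal.ofReal (g x))

/-- `g` is a probability density function with respect to `ν`. -/
structure IsPdf {X : Type*} [MeasurableSpace X] (ν : Measure X) (g : X → ℝ) : Prop where
  measurable : Measurable g
  nonneg : ∀ x, 0 ≤ g x
  lintegral_eq_one : ∫⁻ x, ENNReal.ofReal (g x) ∂ν = 1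

/-- `0 < E_m [log (f_m(X) / f_{m'}(X))] < ∞` for all `m ≠ m'`. Under `P_m` one has `f_m(X) > 0`
almost surely, and the log-likelihood ratio is `+∞` where `f_{m'}` vanishes; its negative part
always has a finite expectation. So finiteness of the expectation says that `f_{m'}(X) > 0`
almost surely under `P_m` and that the (then real-valued) log-likelihood ratio is integrable. -/
def FinitePositiveKL {X : Type*} [MeasurableSpace X] {M : ℕ} (ν : Measure X)
    (f : Fin M → X → ℝ) : Prop :=
  ∀ m m' : Fin M, m ≠ m' →
    (∀ᵐ x ∂(law ν (f m)), 0 < f m' x) ∧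
    Integrable (fun x => Real.log (f m x / f m' x)) (law ν (f m)) ∧
    0 < ∫ x, Real.log (f m x / f m' x) ∂(law ν (f m))

/-- The set `Φ` of deterministic quantizers with messages in `{0, …, l - 1}`. -/
abbrev DetQuantizer (X : Type*) [MeasurableSpace X] (l : ℕ) : Type _ :=
  {φ : X → Fin l // Measurable φ}

/-- The set of all quantizers: a quantizer assigns probability masses to a finite or countable
subset of `Φ` (the support of a `PMF` is countable). -/
abbrev Quantizer (X : Type*) [MeasurableSpace X] (l : ℕ) : Type _ :=
  PMF (DetQuantizer X l)

/-- `P(φ(X) = u)` when the raw observation has density `g`. -/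
def msgProb {X : Type*} [MeasurableSpace X] {l : ℕ} (ν : Measure X) (g : X → ℝ)
    (φ : DetQuantizer X l) (u : Fin l) : ℝ :=
  (law ν g).real {x | φ.1 x = u}

/-- `I(m, m'; φ)` for a deterministic quantizer, with `0 log (0/0) = 0`. -/
def detInfo {X : Type*} [MeasurableSpace X] {M l : ℕ} (ν : Measure X) (f : Fin M → X → ℝ)
    (m m' : Fin M) (φ : DetQuantizer X l) : ℝ :=
  ∑ u : Fin l, msgProb ν (f m) φ u * Real.log (msgProb ν (f m) φ u / msgProb ν (f m') φ u)

/-- `I(m, m'; φ)` for a general quantizer `∑ pʲ φʲ`: the weighted average `∑ pʲ I(m, m'; φʲ)`. -/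
def pairInfo {X : Type*} [MeasurableSpace X] {M l : ℕ} (ν : Measure X) (f : Fin M → X → ℝ)
    (m m' : Fin M) (q : Quantizer X l) : ℝ :=
  ∑' φ : DetQuantizer X l, (q φ).toReal * detInfo ν f m m' φ

/-- `I(m; φ) = min_{m' ≠ m} I(m, m'; φ)`. -/
def info {X : Type*} [MeasurableSpace X] {M l : ℕ} (ν : Measure X) (f : Fin M → X → ℝ)
    (m : Fin M) (q : Quantizer X l) : ℝ :=
  ⨅ m' : {m' : Fin M // m' ≠ m}, pairInfo ν f m m'.1 q

/-- The maximin information number `I(m)`, for messages in an alphabet of size `l`. -/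
def maximinInfo {X : Type*} [MeasurableSpace X] {M : ℕ} (ν : Measure X) (f : Fin M → X → ℝ)
    (l : ℕ) (m : Fin M) : ℝ :=
  ⨆ q : Quantizer X l, info ν f m q

/-- `q` is a maximin quantizer with respect to `P_m`. -/
def IsMaximin {X : Type*} [MeasurableSpace X] {M l : ℕ} (ν : Measure X) (f : Fin M → X → ℝ)
    (m : Fin M) (q : Quantizer X l) : Prop :=
  ∀ q' : Quantizer X l, info ν f m q' ≤ info ν f m q

/-- `i` minimizes `∑_m a_{i,m} f_m(x)` over the alphabet. -/
def IsArgmin {X : Type*} {M l : ℕ} (f : Fin M → X → ℝ) (a : Fin l → Fin M → ℝ) (x : X)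
    (i : Fin l) : Prop :=
  ∀ j : Fin l, ∑ m, a i m * f m x ≤ ∑ m, a j m * f m x

/-- Unambiguous likelihood quantizers: `φ(x)` minimizes `∑_m a_{i,m} f_m(x)` over `i`, and a tie
(two distinct minimizers) has probability zero under every hypothesis. -/
def IsULQ {X : Type*} [MeasurableSpace X] {M l : ℕ} (ν : Measure X) (f : Fin M → X → ℝ)
    (φ : DetQuantizer X l) : Prop :=
  ∃ a : Fin l → Fin M → ℝ,
    (∀ x, IsArgmin f a x (φ.1 x)) ∧
    ∀ m : Fin M, law ν (f m) {x | ∃ i j : Fin l, i ≠ j ∧ IsArgmin f a x i ∧ IsArgmin f a x j} = 0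

end Decentralized

end

/-! Replace deterministic quantizers by randomized decision rules. Their message distributions form
a compact convex set `ruleSet` (weak-* compactness in `L²`), on which the vector of divergences from
hypothesis `m` is continuous and convex (`continuousOn_infoVec`, `convexOn_infoVec`). Let `D` be its
image. Every quantizer has its information vector in the compact convex hull of `D`
(`pairInfo_mem_convexHull`), so the minimal coordinate has a maximum there.

By convexity, splitting a rule into a mixture can only raise its divergences. So the maximum is
reached using only points of any `S ⊆ ruleSet` whose convex hull contains `ruleSet`. The number of
points needed is at most the number `M - 1` of coordinates: a combination of `M` affinely
independent points with positive weights would be interior to their hull, and all its coordinates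
could be increased (`exists_maximin_combination`).

Two choices of `S` give the two claims. Extreme points of `ruleSet` come from deterministic
quantizers (`exists_detRule_of_mem_extremePoints`), and Minkowski's theorem says they suffice.
Limits of ULQ distributions also suffice: almost every linear cost has no ties, so a ULQ minimizes
it, and Hahn–Banach applies (`ruleSet_subset_convexHull_closure_ulqSet`). Approximating each limit
with the weights held fixed gives the sequence. -/

namespace Decentralized

/-! ### Convex geometry in finite dimension: compact hulls and Minkowski's theorem. -/

section ConvexGeometry

variable {E : Type*} [NormedAddCommGroup E] [NormedSpace ℝ E]

/-- The convex hull of a compact set in a finite-dimensional space is compact. -/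
theorem isCompact_convexHull [FiniteDimensional ℝ E] {s : Set E} (hs : IsCompact s) :
    IsCompact (convexHull ℝ s) := by
  rcases s.eq_empty_or_nonempty with rfl | ⟨x₀, hx₀⟩
  · simp
  set n := Module.finrank ℝ E + 1
  -- Carathéodory: at most `n` points are needed. Shorter combinations are padded with weight `0` at
  -- `x₀`, so the hull is a continuous image of a compact set.
  have key : convexHull ℝ s = (fun p : (Fin n → ℝ) × (Fin n → E) => ∑ i, p.1 i • p.2 i) ''
      (stdSimplex ℝ (Fin n) ×ˢ Set.univ.pi fun _ => s) := by
    apply Set.Subset.antisymm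
    · intro x hx
      obtain ⟨ι, _, z, w, hz, hind, hw, hw1, rfl⟩ := eq_pos_convex_span_of_mem_convexHull hx
      have hcard : Fintype.card ι ≤ Fintype.card (Fin n) := by
        rw [Fintype.card_fin]
        exact hind.card_le_finrank_succ.trans (Nat.succ_le_succ (Submodule.finrank_le _))
      obtain ⟨e⟩ := Function.Embedding.nonempty_of_card_le hcard
      have hext : ∀ i, Function.extend e w 0 (e i) = w i := fun i => e.injective.extend_apply ..
      have hext' : ∀ i, Function.extend e z (fun _ => x₀) (e i) = z i :=
        fun i => e.injective.extend_apply ..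
      have hext0 : ∀ j, j ∉ Set.range e → Function.extend e w 0 j = 0 := fun j hj =>
        Function.extend_apply' _ _ _ (by simpa using hj)
      refine ⟨(Function.extend e w 0, Function.extend e z fun _ => x₀), ⟨⟨fun j => ?_, ?_⟩, ?_⟩, ?_⟩
      · by_cases hj : j ∈ Set.range e
        · obtain ⟨i, rfl⟩ := hj
          simpa [hext] using (hw i).le
        · simp [hext0 j hj]
      · rw [← hw1]
        exact (Fintype.sum_of_injective e e.injective _ _ hext0 fun i => (hext i).symm).symm
      · intro j _
        by_cases hj : j ∈ Set.range e
        · obtain ⟨i, rfl⟩ := hj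
          simpa [hext'] using hz ⟨i, rfl⟩
        · have : Function.extend e z (fun _ => x₀) j = x₀ :=
            Function.extend_apply' _ _ _ (by simpa using hj)
          simpa [this] using hx₀
      · refine (Fintype.sum_of_injective e e.injective _ _ (fun j hj => ?_) fun i => ?_).symm
        · simp [hext0 j hj]
        · simp [hext, hext']
    · rintro _ ⟨⟨w, z⟩, ⟨hw, hz⟩, rfl⟩
      exact (convex_convexHull ℝ s).sum_mem (fun i _ => hw.1 i) hw.2
        fun i _ => subset_convexHull ℝ s (hz i trivial)
  rw [key]
  exact ((isCompact_stdSimplex ℝ _).prod (isCompact_univ_pi fun _ => hs)).image (by fun_prop)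

/-- The directions in which one can move from `x` both ways without leaving the convex set `s`. -/
def freeDirections {s : Set E} (hs : Convex ℝ s) {x : E} (hx : x ∈ s) : Submodule ℝ E where
  carrier := {v | ∃ ε > 0, ∀ t : ℝ, |t| ≤ ε → x + t • v ∈ s}
  zero_mem' := ⟨1, one_pos, fun t _ => by simpa using hx⟩
  add_mem' := by
    rintro u v ⟨ε, hε, hu⟩ ⟨δ, hδ, hv⟩
    refine ⟨min ε δ / 2, by positivity, fun t ht => ?_⟩
    have h2 : |2 * t| ≤ min ε δ := by rw [abs_mul, abs_two]; linarith
    have := hs (hu _ (h2.trans (min_le_left _ _))) (hv _ (h2.trans (min_le_right _ _)))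
      (by norm_num : (0 : ℝ) ≤ 1 / 2) (by norm_num : (0 : ℝ) ≤ 1 / 2) (by norm_num)
    convert this using 1
    module
  smul_mem' := by
    rintro c v ⟨ε, hε, hv⟩
    refine ⟨ε / (|c| + 1), by positivity, fun t ht => ?_⟩
    rw [smul_smul]
    apply hv
    rw [abs_mul]
    rw [le_div_iff₀ (by positivity)] at ht
    nlinarith [abs_nonneg t, abs_nonneg c]

theorem mem_freeDirections {s : Set E} (hs : Convex ℝ s) {x : E} (hx : x ∈ s) {v : E} :
    v ∈ freeDirections hs hx ↔ ∃ ε > 0, ∀ t : ℝ, |t| ≤ ε → x + t • v ∈ s := Iff.rfl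

/-- Moving along a free direction as far as possible leaves fewer free directions. -/
theorem exists_freeDirections_lt {s : Set E} (hsc : IsCompact s) (hs : Convex ℝ s) {x v : E}
    (hx : x ∈ s) (hv : v ∈ freeDirections hs hx) (hv0 : v ≠ 0) :
    ∃ t : ℝ, 0 < t ∧ ∃ hy : x + t • v ∈ s, freeDirections hs hy < freeDirections hs hx := by
  obtain ⟨ε, hε, hεv⟩ := (mem_freeDirections hs hx).1 hv
  have hT : IsCompact ((fun t : ℝ => x + t • v) ⁻¹' s) :=
    ((Homeomorph.addLeft x).isClosedEmbedding.comp
      (isClosedEmbedding_smul_left hv0)).isCompact_preimage hsc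
  obtain ⟨t, ht, hmax⟩ := hT.exists_isMaxOn ⟨0, by simpa using hx⟩ continuousOn_id
  have hεt : ε ≤ t := hmax (hεv ε (abs_of_pos hε).le)
  have ht0 : 0 < t := hε.trans_le hεt
  refine ⟨t, ht0, ht, lt_of_le_of_ne ?_ ?_⟩
  · rintro u ⟨δ, hδ, hu⟩
    have hz : x + (-ε) • v ∈ s := hεv _ (by rw [abs_neg, abs_of_pos hε])
    refine ⟨ε / (ε + t) * δ, by positivity, fun r hr => ?_⟩
    have h1 : |r * ((ε + t) / ε)| ≤ δ := by
      rw [abs_mul, abs_of_pos (show 0 < (ε + t) / ε by positivity)]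
      calc |r| * ((ε + t) / ε) ≤ ε / (ε + t) * δ * ((ε + t) / ε) := by gcongr
        _ = δ := by field_simp
    have := hs (hu _ h1) hz (show 0 ≤ ε / (ε + t) by positivity)
      (show 0 ≤ t / (ε + t) by positivity) (by field_simp)
    convert this using 1
    match_scalars <;> (field_simp; try ring)
  -- The inclusion is strict because `v` itself is no longer free: `t` was maximal.
  · intro h
    rw [← h] at hv
    obtain ⟨δ, hδ, hδv⟩ := hv
    have h1 := hδv δ (abs_of_pos hδ).le
    have h2 : t + δ ≤ t := hmax (show x + (t + δ) • v ∈ s by rwa [add_smul, ← add_assoc])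
    linarith

/-- Minkowski's theorem: a compact convex set in a finite-dimensional space is the convex hull of
its extreme points. -/
theorem convexHull_extremePoints_eq [FiniteDimensional ℝ E] {s : Set E} (hsc : IsCompact s)
    (hs : Convex ℝ s) : convexHull ℝ (s.extremePoints ℝ) = s := by
  refine (convexHull_min extremePoints_subset hs).antisymm fun x hx => ?_
  induction hn : Module.finrank ℝ (freeDirections hs hx) using Nat.strong_induction_on
    generalizing x with
  | _ n ih =>
    by_cases hext : x ∈ s.extremePoints ℝ
    · exact subset_convexHull ℝ _ hext
    have : ∃ v ∈ freeDirections hs hx, v ≠ 0 := by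
      rw [mem_extremePoints] at hext
      push Not at hext
      obtain ⟨x₁, h₁, x₂, h₂, ⟨a, b, ha, hb, hab, rfl⟩, hne⟩ := hext hx
      refine ⟨x₂ - x₁, ⟨min a b, by positivity, fun t ht => ?_⟩, fun h => ?_⟩
      · obtain ⟨ht1, ht2⟩ := abs_le.1 ht
        have := hs h₁ h₂ (show 0 ≤ a - t by linarith [min_le_left a b])
          (show 0 ≤ b + t by linarith [min_le_right a b]) (by linarith)
        convert this using 1
        module
      · obtain rfl : x₂ = x₁ := sub_eq_zero.1 h
        have : a • x₂ + b • x₂ = x₂ := by rw [← add_smul, hab, one_smul]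
        exact hne this.symm this.symm
    obtain ⟨v, hv, hv0⟩ := this
    obtain ⟨t, ht, hy, hlt⟩ := exists_freeDirections_lt hsc hs hx hv hv0
    -- `x` lies between the two ends of its chord along `v`, and the induction hypothesis covers
    -- both ends.
    obtain ⟨r, hr, hz, hlt'⟩ := exists_freeDirections_lt hsc hs hx (neg_mem hv) (neg_ne_zero.2 hv0)
    have h1 := ih _ (hn ▸ Submodule.finrank_lt_finrank_of_lt hlt) _ hy rfl
    have h2 := ih _ (hn ▸ Submodule.finrank_lt_finrank_of_lt hlt') _ hz rfl
    have := convex_convexHull ℝ _ h1 h2 (show 0 ≤ r / (r + t) by positivity)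
      (show 0 ≤ t / (r + t) by positivity) (by field_simp)
    convert this using 1
    match_scalars <;> (field_simp; try ring)

end ConvexGeometry

/-! ### Maximizing the smallest coordinate over a convex hull. -/

section Maximin

variable {ι : Type*} [Fintype ι] [Nonempty ι]

theorem tendsto_iInf_apply {α : Type*} {F : Filter α} {u : α → ι → ℝ} {y : ι → ℝ}
    (h : Tendsto u F (𝓝 y)) : Tendsto (fun a => ⨅ i, u a i) F (𝓝 (⨅ i, y i)) := by
  simp_rw [← Finset.inf'_univ_eq_ciInf]
  exact Tendsto.finset_inf'_nhds_apply Finset.univ_nonempty fun i _ => (tendsto_pi_nhds.1 h) i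

theorem iInf_mono_of_le {ι : Type*} [Finite ι] {y z : ι → ℝ} (h : y ≤ z) : ⨅ i, y i ≤ ⨅ i, z i :=
  ciInf_mono (Set.finite_range y).bddBelow h

theorem iInf_lt_of_forall_lt {y z : ι → ℝ} (h : ∀ i, y i < z i) : ⨅ i, y i < ⨅ i, z i := by
  obtain ⟨j, hj⟩ := exists_eq_ciInf_of_finite (f := z)
  rw [← hj]
  exact (ciInf_le (Set.finite_range y).bddBelow j).trans_lt (h j)

/-- If every point of the compact set `D` is dominated by a convex combination of points of
`K ⊆ D`, then the largest minimal coordinate over the convex hull of `D` is attained by a convex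
combination of at most `card ι` points of `K`. -/
theorem exists_maximin_combination {D K : Set (ι → ℝ)} (hD : IsCompact D) (hne : D.Nonempty)
    (hKD : K ⊆ D) (hdom : ∀ d ∈ D, ∃ z ∈ convexHull ℝ K, d ≤ z) :
    ∃ (n : ℕ) (z : Fin n → ι → ℝ) (w : Fin n → ℝ), n ≤ Fintype.card ι ∧ (∀ i, z i ∈ K) ∧
      (∀ i, 0 ≤ w i) ∧ ∑ i, w i = 1 ∧
      ∀ y ∈ convexHull ℝ D, ⨅ j, y j ≤ ⨅ j, (∑ i, w i • z i) j := by
  classical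
  have hcont : Continuous fun y : ι → ℝ => ⨅ j, y j :=
    continuous_iff_continuousAt.2 fun y => tendsto_iInf_apply tendsto_id
  obtain ⟨y, hy, hmax⟩ := (isCompact_convexHull hD).exists_isMaxOn hne.convexHull hcont.continuousOn
  have hsub : convexHull ℝ D ⊆ {d | ∃ z ∈ convexHull ℝ K, d ≤ z} := by
    refine convexHull_min hdom ?_
    rintro d ⟨z, hz, hdz⟩ d' ⟨z', hz', hdz'⟩ a b ha hb hab
    exact ⟨_, convex_convexHull ℝ K hz hz' ha hb hab,
      add_le_add (smul_le_smul_of_nonneg_left hdz ha) (smul_le_smul_of_nonneg_left hdz' hb)⟩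
  obtain ⟨x, hx, hyx⟩ := hsub hy
  have hxmax : ∀ y' ∈ convexHull ℝ D, ⨅ j, y' j ≤ ⨅ j, x j := fun y' hy' =>
    (hmax hy').trans (iInf_mono_of_le hyx)
  obtain ⟨κ, _, z, w, hz, hind, hw, hw1, rfl⟩ := eq_pos_convex_span_of_mem_convexHull hx
  -- One point more would make `z` an affine basis and, all weights being positive, the maximizer an
  -- interior point of the hull; a shift by a small `t > 0` in every coordinate would then beat it.
  have hcard : Fintype.card κ ≤ Fintype.card ι := by
    by_contra! hlt
    have hle := hind.card_le_finrank_succ.trans (Nat.succ_le_succ (Submodule.finrank_le _))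
    rw [Module.finrank_fintype_fun_eq_card] at hle
    have htop : affineSpan ℝ (Set.range z) = ⊤ :=
      hind.affineSpan_eq_top_iff_card_eq_finrank_add_one.2
        (by rw [Module.finrank_fintype_fun_eq_card]; omega)
    let b : AffineBasis κ ℝ (ι → ℝ) := ⟨z, hind, htop⟩
    have hint : ∑ i, w i • z i ∈ interior (convexHull ℝ (Set.range z)) := by
      change _ ∈ interior (convexHull ℝ (Set.range b))
      rw [b.interior_convexHull]
      intro i
      rw [← Finset.univ.affineCombination_eq_linear_combination z w hw1]
      change 0 < b.coord i (Finset.univ.affineCombination ℝ b w)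
      rw [b.coord_apply_combination_of_mem (Finset.mem_univ i) hw1]
      exact hw i
    have hlim : Tendsto (fun t : ℝ => ∑ i, w i • z i + t • (fun _ => 1 : ι → ℝ)) (𝓝[>] 0)
        (𝓝 (∑ i, w i • z i)) := by
      have : Continuous fun t : ℝ => ∑ i, w i • z i + t • (fun _ => 1 : ι → ℝ) := by fun_prop
      simpa using (this.tendsto 0).mono_left nhdsWithin_le_nhds
    obtain ⟨t, ht, ht0⟩ := ((hlim.eventually (isOpen_interior.mem_nhds hint)).and
      self_mem_nhdsWithin).exists
    have ht1 := hxmax _ (convexHull_mono (hz.trans hKD) (interior_subset ht))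
    refine ht1.not_gt (iInf_lt_of_forall_lt fun i => ?_)
    simpa using ht0
  let e := Fintype.equivFin κ
  refine ⟨Fintype.card κ, z ∘ e.symm, w ∘ e.symm, hcard, fun i => hz ⟨_, rfl⟩,
    fun i => (hw _).le, ?_, ?_⟩
  · rw [← hw1]; exact e.symm.sum_comp w
  · have : ∑ i, (w ∘ e.symm) i • (z ∘ e.symm) i = ∑ i, w i • z i :=
      e.symm.sum_comp fun i => w i • z i
    rwa [this]

end Maximin

/-! ### Convexity of `a log (a / b)`. -/

section EntropyTerm

/-- One summand `a log (a / b)` of a relative entropy. -/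
noncomputable def klTerm (p : ℝ × ℝ) : ℝ := p.1 * Real.log (p.1 / p.2)

/-- The pairs of masses that two equivalent measures can give to one event. -/
def massPairs : Set (ℝ × ℝ) := {p | (0 < p.1 ∧ 0 < p.2) ∨ (p.1 = 0 ∧ p.2 = 0)}

/-- From `log y ≤ y - 1` at `y = c b / a`. The left side is linear in `p` and is the tangent along
the ray `a / b = c`, so `klTerm` is a supremum of linear functions. -/
theorem le_klTerm {p : ℝ × ℝ} (hp : p ∈ massPairs) {c : ℝ} (hc : 0 < c) :
    p.1 * Real.log c + p.1 - c * p.2 ≤ klTerm p := by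
  obtain ⟨a, b⟩ := p
  rcases hp with ⟨ha, hb⟩ | ⟨ha, hb⟩ <;> simp only at ha hb
  · have h := Real.log_le_sub_one_of_pos (show 0 < c * b / a by positivity)
    rw [Real.log_div (by positivity) ha.ne', Real.log_mul hc.ne' hb.ne'] at h
    simp only [klTerm]
    rw [Real.log_div ha.ne' hb.ne']
    have h2 := mul_le_mul_of_nonneg_left h ha.le
    rw [mul_sub a (c * b / a) 1, mul_div_cancel₀ _ ha.ne'] at h2
    linarith
  · simp [klTerm, ha, hb]

theorem convex_massPairs : Convex ℝ massPairs := by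
  rintro ⟨a, b⟩ hp ⟨a', b'⟩ hp' s t hs ht hst
  rcases hs.eq_or_lt with rfl | hs
  · obtain rfl : t = 1 := by linarith
    simpa using hp'
  rcases ht.eq_or_lt with rfl | ht
  · obtain rfl : s = 1 := by linarith
    simpa using hp
  simp only [massPairs, Set.mem_ofPred_eq, Prod.smul_mk, Prod.mk_add_mk, smul_eq_mul] at *
  rcases hp with ⟨h1, h2⟩ | ⟨rfl, rfl⟩ <;> rcases hp' with ⟨h3, h4⟩ | ⟨rfl, rfl⟩
  · left; constructor <;> positivity
  · left; constructor <;> simp <;> positivity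
  · left; constructor <;> simp <;> positivity
  · right; simp

theorem convexOn_klTerm : ConvexOn ℝ massPairs klTerm := by
  refine ⟨convex_massPairs, fun p hp p' hp' s t hs ht hst => ?_⟩
  rcases convex_massPairs hp hp' hs ht hst with ⟨hA, hB⟩ | ⟨hA, hB⟩
  -- The tangent with slope `c = q.1 / q.2` is exact at the mixture `q` and lies below at both ends.
  · set q := s • p + t • p' with hq
    have hc : 0 < q.1 / q.2 := div_pos hA hB
    have h1 := mul_le_mul_of_nonneg_left (le_klTerm hp hc) hs
    have h2 := mul_le_mul_of_nonneg_left (le_klTerm hp' hc) ht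
    have e1 : q.1 = s * p.1 + t * p'.1 := rfl
    have e2 : q.2 = s * p.2 + t * p'.2 := rfl
    have e3 : q.1 / q.2 * q.2 = q.1 := div_mul_cancel₀ _ hB.ne'
    calc klTerm q = (s * p.1 + t * p'.1) * Real.log (q.1 / q.2) + (s * p.1 + t * p'.1)
          - q.1 / q.2 * q.2 := by rw [e3, ← e1, klTerm]; ring
      _ ≤ _ := by
        rw [smul_eq_mul, smul_eq_mul]
        conv_lhs => rw [show q.1 / q.2 * q.2 = q.1 / q.2 * (s * p.2 + t * p'.2) by rw [← e2]]
        linarith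
  · have hzero : ∀ (r : ℝ) (a : ℝ × ℝ), a ∈ massPairs → 0 ≤ r → 0 ≤ r * a.1 := by
      rintro r a (⟨h, -⟩ | ⟨h, -⟩) hr
      · positivity
      · simp [h]
    have h1 := hzero s p hp hs
    have h2 := hzero t p' hp' ht
    have e : s * p.1 + t * p'.1 = 0 := hA
    have h3 : s * p.1 = 0 := by linarith
    have h4 : t * p'.1 = 0 := by linarith
    have : klTerm (s • p + t • p') = 0 := by simp [klTerm, hA]
    rw [this, smul_eq_mul, smul_eq_mul, klTerm, klTerm, ← mul_assoc, h3, ← mul_assoc, h4]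
    simp

end EntropyTerm

/-! ### Divergence terms of tests, and their continuity. -/

section LikelihoodFamily

variable {X : Type*} [MeasurableSpace X] {M l : ℕ} {μ : Measure X} {h : Fin M → X → ℝ}

/-- Almost everywhere positive densities with sum one and pairwise finite relative entropies. -/
structure LikelihoodFamily (μ : Measure X) (h : Fin M → X → ℝ) : Prop where
  measurable : ∀ m, Measurable (h m)
  pos : ∀ m, ∀ᵐ x ∂μ, 0 < h m x
  sum_eq_one : ∀ᵐ x ∂μ, ∑ m, h m x = 1
  integrable : ∀ m m', m ≠ m' → Integrable (fun x => h m x * Real.log (h m x / h m' x)) μ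

/-- A measurable function with values in `[0, 1]`, up to null sets. -/
structure IsTest (μ : Measure X) (t : X → ℝ) : Prop where
  measurable : Measurable t
  nonneg : ∀ᵐ x ∂μ, 0 ≤ t x
  le_one : ∀ᵐ x ∂μ, t x ≤ 1

theorem LikelihoodFamily.le_one (H : LikelihoodFamily μ h) (m : Fin M) :
    ∀ᵐ x ∂μ, h m x ≤ 1 := by
  filter_upwards [H.sum_eq_one, ae_all_iff.2 H.pos] with x h1 h2
  rw [← h1]
  exact Finset.single_le_sum (f := fun m => h m x) (fun i _ => (h2 i).le) (Finset.mem_univ m)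

theorem LikelihoodFamily.isTest (H : LikelihoodFamily μ h) (m : Fin M) : IsTest μ (h m) :=
  ⟨H.measurable m, (H.pos m).mono fun _ => le_of_lt, H.le_one m⟩

theorem IsTest.mul {s t : X → ℝ} (hs : IsTest μ s) (ht : IsTest μ t) :
    IsTest μ fun x => s x * t x := by
  refine ⟨hs.measurable.mul ht.measurable, ?_, ?_⟩
  · filter_upwards [hs.nonneg, ht.nonneg] with x h1 h2 using mul_nonneg h1 h2
  · filter_upwards [hs.le_one, ht.nonneg, ht.le_one] with x h1 h2 h3 using mul_le_one₀ h1 h2 h3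

theorem IsTest.integrable_mul {t g : X → ℝ} (ht : IsTest μ t) (hg : Integrable g μ) :
    Integrable (fun x => t x * g x) μ := by
  refine hg.mono (ht.measurable.aestronglyMeasurable.mul hg.aestronglyMeasurable) ?_
  filter_upwards [ht.nonneg, ht.le_one] with x h1 h2
  rw [norm_mul, Real.norm_of_nonneg h1]
  exact mul_le_of_le_one_left (norm_nonneg _) h2

theorem IsTest.integrable [IsFiniteMeasure μ] {t : X → ℝ} (ht : IsTest μ t) : Integrable t μ := by
  simpa using ht.integrable_mul (integrable_const (1 : ℝ))

/-- All densities are positive a.e., so one vanishing mass forces the test to vanish a.e., and with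
it every other mass. -/
theorem LikelihoodFamily.mem_massPairs [IsFiniteMeasure μ] (H : LikelihoodFamily μ h)
    {t : X → ℝ} (ht : IsTest μ t) (m m' : Fin M) :
    (∫ x, t x * h m x ∂μ, ∫ x, t x * h m' x ∂μ) ∈ massPairs := by
  have hnn : ∀ k, 0 ≤ ∫ x, t x * h k x ∂μ := fun k =>
    integral_nonneg_of_ae (ht.mul (H.isTest k)).nonneg
  have hz : ∀ k k', ∫ x, t x * h k x ∂μ = 0 → ∫ x, t x * h k' x ∂μ = 0 := by
    intro k k' hk
    rw [integral_eq_zero_iff_of_nonneg_ae (ht.mul (H.isTest k)).nonneg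
      (ht.mul (H.isTest k)).integrable] at hk
    refine integral_eq_zero_of_ae ?_
    filter_upwards [hk, H.pos k] with x h1 h2
    have : t x = 0 := by simpa [h2.ne'] using h1
    simp [this]
  rcases (hnn m).eq_or_lt with h0 | hpos
  · exact Or.inr ⟨h0.symm, hz m m' h0.symm⟩
  · exact Or.inl ⟨hpos, (hnn m').lt_of_ne fun h0 => hpos.ne' (hz m' m h0.symm)⟩

/-- Replacing an observation by the outcome of a test does not increase the divergence. -/
theorem LikelihoodFamily.klTerm_le [IsFiniteMeasure μ] (H : LikelihoodFamily μ h)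
    {t : X → ℝ} (ht : IsTest μ t) {m m' : Fin M} (hm : m ≠ m') :
    klTerm (∫ x, t x * h m x ∂μ, ∫ x, t x * h m' x ∂μ) ≤
      ∫ x, t x * (h m x * Real.log (h m x / h m' x)) ∂μ := by
  have I := fun k => (ht.mul (H.isTest k)).integrable
  rcases H.mem_massPairs ht m m' with ⟨hA, hB⟩ | ⟨hA, hB⟩
  · simp only at hA hB
    set A := ∫ x, t x * h m x ∂μ
    set B := ∫ x, t x * h m' x ∂μ
    have hc : 0 < A / B := div_pos hA hB
    calc klTerm (A, B) = A * (Real.log (A / B) + 1) - A / B * B := by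
          rw [div_mul_cancel₀ _ hB.ne', klTerm]; ring
      _ = ∫ x, (t x * h m x) * (Real.log (A / B) + 1) - A / B * (t x * h m' x) ∂μ := by
          rw [integral_sub ((I m).mul_const _) ((I m').const_mul _), integral_mul_const,
            integral_const_mul]
      -- Integrate the tangent bound of slope `A / B` against `t`.
      _ ≤ _ := by
          refine integral_mono_ae (((I m).mul_const _).sub ((I m').const_mul _))
            (ht.integrable_mul (H.integrable m m' hm)) ?_
          filter_upwards [ht.nonneg, H.pos m, H.pos m'] with x h1 h2 h3
          have := mul_le_mul_of_nonneg_left (le_klTerm (p := (h m x, h m' x)) (.inl ⟨h2, h3⟩) hc) h1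
          simp only [klTerm] at this
          linarith
  · simp only at hA
    rw [hA, klTerm, zero_mul]
    refine (integral_eq_zero_of_ae ?_).ge
    rw [integral_eq_zero_iff_of_nonneg_ae (ht.mul (H.isTest m)).nonneg (I m)] at hA
    filter_upwards [hA] with x hx
    simp only [Pi.zero_apply] at hx ⊢
    rw [← mul_assoc, hx, zero_mul]

/-- The part of the log-likelihood ratio above level `N` is asymptotically negligible. -/
theorem LikelihoodFamily.tendsto_tail (H : LikelihoodFamily μ h) {m m' : Fin M} (hm : m ≠ m') :
    Tendsto (fun N : ℕ => ∫ x, |h m x * Real.log (h m x / h m' x)| -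
      min |h m x * Real.log (h m x / h m' x)| (N * h m x) ∂μ) atTop (𝓝 0) := by
  set g := fun x => h m x * Real.log (h m x / h m' x)
  have hg : Measurable g := (H.measurable m).mul ((H.measurable m).div (H.measurable m')).log
  rw [← integral_zero X ℝ]
  refine tendsto_integral_of_dominated_convergence (fun x => |g x|) (fun N => ?_)
    (H.integrable m m' hm).abs (fun N => ?_) ?_
  · exact (hg.abs.sub (hg.abs.min ((H.measurable m).const_mul _))).aestronglyMeasurable
  · filter_upwards [H.pos m] with x hx
    have h1 : 0 ≤ min |g x| (N * h m x) := le_min (abs_nonneg _) (by positivity)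
    rw [Real.norm_of_nonneg (sub_nonneg.2 (min_le_left _ _))]
    linarith
  · filter_upwards [H.pos m] with x hx
    refine tendsto_const_nhds.congr' ?_
    obtain ⟨N, hN⟩ := exists_nat_ge (|g x| / h m x)
    filter_upwards [eventually_ge_atTop N] with n hn
    rw [min_eq_left, sub_self]
    rw [div_le_iff₀ hx] at hN
    exact hN.trans (by gcongr)

/-- Cutting the log-likelihood integrand at level `N * h m` leaves a remainder that does not depend
on the test. This gives uniform control as the mass tends to zero. -/
theorem LikelihoodFamily.klTerm_le_add [IsFiniteMeasure μ] (H : LikelihoodFamily μ h)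
    {t : X → ℝ} (ht : IsTest μ t) {m m' : Fin M} (hm : m ≠ m') (N : ℕ) :
    klTerm (∫ x, t x * h m x ∂μ, ∫ x, t x * h m' x ∂μ) ≤
      N * (∫ x, t x * h m x ∂μ) + ∫ x, |h m x * Real.log (h m x / h m' x)| -
      min |h m x * Real.log (h m x / h m' x)| (N * h m x) ∂μ := by
  refine (H.klTerm_le ht hm).trans ?_
  have I1 := (ht.mul (H.isTest m)).integrable.const_mul (N : ℝ)
  have I2 : Integrable (fun x => |h m x * Real.log (h m x / h m' x)| -
      min |h m x * Real.log (h m x / h m' x)| (N * h m x)) μ :=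
    (H.integrable m m' hm).abs.sub
      ((H.integrable m m' hm).abs.inf ((H.isTest m).integrable.const_mul _))
  rw [← integral_const_mul, ← integral_add I1 I2]
  refine integral_mono_ae (ht.integrable_mul (H.integrable m m' hm)) (I1.add I2) ?_
  filter_upwards [ht.nonneg, ht.le_one] with x h1 h2
  set g := h m x * Real.log (h m x / h m' x)
  have h3 : t x * g ≤ t x * |g| := mul_le_mul_of_nonneg_left (le_abs_self _) h1
  have h4 : t x * min |g| (N * h m x) ≤ t x * (N * h m x) :=
    mul_le_mul_of_nonneg_left (min_le_right _ _) h1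
  have h5 : t x * (|g| - min |g| (N * h m x)) ≤ |g| - min |g| (N * h m x) :=
    mul_le_of_le_one_left (sub_nonneg.2 (min_le_left _ _)) h2
  linarith

/-- The delicate point is `(0, 0)`, where `klTerm` is discontinuous on `massPairs`. On pairs
realized by tests, integrability of the log-likelihood ratio restores continuity: the tangent with
`c = 1` bounds from below, truncation from above. -/
theorem LikelihoodFamily.continuousOn_klTerm [IsFiniteMeasure μ] (H : LikelihoodFamily μ h)
    {m m' : Fin M} (hm : m ≠ m') :
    ContinuousOn klTerm
      {p | ∃ t, IsTest μ t ∧ p = (∫ x, t x * h m x ∂μ, ∫ x, t x * h m' x ∂μ)} := by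
  rintro p₀ ⟨t₀, ht₀, rfl⟩
  rcases H.mem_massPairs ht₀ m m' with ⟨hA, hB⟩ | ⟨hA, hB⟩
  · refine ContinuousAt.continuousWithinAt ?_
    exact continuousAt_fst.mul ((continuousAt_fst.div continuousAt_snd hB.ne').log
      (div_pos hA hB).ne')
  · simp only at hA hB
    rw [hA, hB, ContinuousWithinAt, show klTerm (0, 0) = 0 by simp [klTerm], tendsto_order]
    have h1 : Tendsto Prod.fst (𝓝[{p | ∃ t, IsTest μ t ∧
        p = (∫ x, t x * h m x ∂μ, ∫ x, t x * h m' x ∂μ)}] ((0 : ℝ), (0 : ℝ))) (𝓝 0) :=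
      (continuous_fst.tendsto ((0 : ℝ), (0 : ℝ))).mono_left nhdsWithin_le_nhds
    have h2 : Tendsto Prod.snd (𝓝[{p | ∃ t, IsTest μ t ∧
        p = (∫ x, t x * h m x ∂μ, ∫ x, t x * h m' x ∂μ)}] ((0 : ℝ), (0 : ℝ))) (𝓝 0) :=
      (continuous_snd.tendsto ((0 : ℝ), (0 : ℝ))).mono_left nhdsWithin_le_nhds
    refine ⟨fun a ha => ?_, fun a ha => ?_⟩
    · have h3 := h1.sub h2
      rw [sub_zero] at h3
      filter_upwards [h3.eventually (lt_mem_nhds ha), self_mem_nhdsWithin] with p hp hpt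
      obtain ⟨t, ht, rfl⟩ := hpt
      refine hp.trans_le ?_
      simpa using le_klTerm (H.mem_massPairs ht m m') one_pos
    · obtain ⟨N, hN⟩ := ((H.tendsto_tail hm).eventually (gt_mem_nhds (half_pos ha))).exists
      have h3 := h1.const_mul (N : ℝ)
      rw [mul_zero] at h3
      filter_upwards [h3.eventually (gt_mem_nhds (half_pos ha)), self_mem_nhdsWithin] with p hp hpt
      obtain ⟨t, ht, rfl⟩ := hpt
      refine (H.klTerm_le_add ht hm N).trans_lt ?_
      simp only at hp
      linarith

end LikelihoodFamily

/-- Breaking ties by the least index makes each level set a finite Boolean combination of the sets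
`g k ≤ g j`. -/
theorem exists_measurable_argmin {X : Type*} [MeasurableSpace X] {l : ℕ} (hl : 0 < l)
    {g : Fin l → X → ℝ} (hg : ∀ i, Measurable (g i)) :
    ∃ φ : X → Fin l, Measurable φ ∧ ∀ x j, g (φ x) x ≤ g j x := by
  have : Nonempty (Fin l) := ⟨⟨0, hl⟩⟩
  have hex : ∀ x, ∃ i, (∀ j, g i x ≤ g j x) ∧ ∀ k < i, ¬ ∀ j, g k x ≤ g j x := by
    intro x
    obtain ⟨i, hi⟩ := Finite.exists_min fun i => g i x
    obtain ⟨k, hk, hmin⟩ := WellFounded.has_min (wellFounded_lt (α := Fin l))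
      {i | ∀ j, g i x ≤ g j x} ⟨i, hi⟩
    exact ⟨k, hk, fun k' hk' hk'' => hmin k' hk'' hk'⟩
  choose φ hφ hleast using hex
  refine ⟨φ, measurable_to_countable' fun i => ?_, hφ⟩
  have : φ ⁻¹' {i} = {x | (∀ j, g i x ≤ g j x) ∧ ∀ k < i, ¬ ∀ j, g k x ≤ g j x} := by
    ext x
    constructor
    · rintro rfl
      exact ⟨hφ x, hleast x⟩
    · rintro ⟨h1, h2⟩
      rcases lt_trichotomy (φ x) i with h | h | h
      · exact (h2 _ h (hφ x)).elim
      · exact h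
      · exact (hleast x _ h h1).elim
  rw [this]
  have hm : ∀ k, MeasurableSet {x | ∀ j, g k x ≤ g j x} := fun k => by
    rw [Set.ofPred_forall]
    exact MeasurableSet.iInter fun j => measurableSet_le (hg k) (hg j)
  refine (hm i).inter ?_
  change MeasurableSet {x | ∀ k < i, ¬ ∀ j, g k x ≤ g j x}
  simp_rw [Set.ofPred_forall]
  exact MeasurableSet.iInter fun k => MeasurableSet.iInter fun _ => (hm k).compl

/-! ### Randomized rules: compactness and extreme points. -/

section Rules

variable {X : Type*} [MeasurableSpace X] {M l : ℕ} {μ : Measure X} {h : Fin M → X → ℝ}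

/-- A randomized decision rule: `w u x` is the probability of sending `u` when observing `x`. -/
structure IsRule (μ : Measure X) (w : Fin l → X → ℝ) : Prop where
  measurable : ∀ u, Measurable (w u)
  nonneg : ∀ᵐ x ∂μ, ∀ u, 0 ≤ w u x
  sum_eq_one : ∀ᵐ x ∂μ, ∑ u, w u x = 1

theorem IsRule.isTest {w : Fin l → X → ℝ} (hw : IsRule μ w) (u : Fin l) : IsTest μ (w u) := by
  refine ⟨hw.measurable u, hw.nonneg.mono fun _ h => h u, ?_⟩
  filter_upwards [hw.nonneg, hw.sum_eq_one] with x h1 h2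
  rw [← h2]
  exact Finset.single_le_sum (f := fun u => w u x) (fun i _ => h1 i) (Finset.mem_univ u)

/-- The message distributions of a rule under all hypotheses. -/
noncomputable def ruleVec (μ : Measure X) (h : Fin M → X → ℝ) (w : Fin l → X → ℝ) :
    Fin l → Fin M → ℝ :=
  fun u m => ∫ x, w u x * h m x ∂μ

/-- All message distributions of randomized decision rules. -/
def ruleSet (μ : Measure X) (h : Fin M → X → ℝ) (l : ℕ) : Set (Fin l → Fin M → ℝ) :=
  {q | ∃ w, IsRule μ w ∧ q = ruleVec μ h w}

theorem convex_ruleSet [IsFiniteMeasure μ] (H : LikelihoodFamily μ h) :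
    Convex ℝ (ruleSet μ h l) := by
  rintro _ ⟨w, hw, rfl⟩ _ ⟨w', hw', rfl⟩ a b ha hb hab
  refine ⟨fun u x => a * w u x + b * w' u x, ⟨fun u => ?_, ?_, ?_⟩, ?_⟩
  · exact ((hw.measurable u).const_mul a).add ((hw'.measurable u).const_mul b)
  · filter_upwards [hw.nonneg, hw'.nonneg] with x h1 h2 u
    exact add_nonneg (mul_nonneg ha (h1 u)) (mul_nonneg hb (h2 u))
  · filter_upwards [hw.sum_eq_one, hw'.sum_eq_one] with x h1 h2
    rw [Finset.sum_add_distrib, ← Finset.mul_sum, ← Finset.mul_sum, h1, h2, mul_one, mul_one, hab]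
  · ext u m
    have I := ((hw.isTest u).mul (H.isTest m)).integrable
    have I' := ((hw'.isTest u).mul (H.isTest m)).integrable
    simp only [ruleVec, Pi.add_apply, Pi.smul_apply, smul_eq_mul]
    rw [← integral_const_mul, ← integral_const_mul,
      ← integral_add (I.const_mul a) (I'.const_mul b)]
    exact integral_congr_ae (.of_forall fun x => by simp only; ring)

theorem IsTest.memLp [IsFiniteMeasure μ] {t : X → ℝ} (ht : IsTest μ t) : MemLp t 2 μ := by
  refine MemLp.of_bound ht.measurable.aestronglyMeasurable 1 ?_
  filter_upwards [ht.nonneg, ht.le_one] with x h1 h2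
  rwa [Real.norm_of_nonneg h1]

theorem L2_inner_eq_integral_mul (f g : Lp ℝ 2 μ) :
    inner ℝ f g = ∫ x, f x * g x ∂μ := by
  rw [L2.inner_def]
  exact integral_congr_ae (.of_forall fun x => by simp [mul_comm])

/-- The functionals on `L²` that come from randomized decision rules. -/
def ruleFunctionals (μ : Measure X) [IsFiniteMeasure μ] (l : ℕ) :
    Set (Fin l → WeakDual ℝ (Lp ℝ 2 μ)) :=
  {L | (∀ u, L u ∈ WeakDual.toStrongDual ⁻¹'
      Metric.closedBall 0 ‖(memLp_const (μ := μ) (p := 2) (1 : ℝ)).toLp‖) ∧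
    (∀ u, ∀ g : Lp ℝ 2 μ, 0 ≤ g → 0 ≤ L u g) ∧ ∀ g : Lp ℝ 2 μ, ∑ u, L u g = ∫ x, g x ∂μ}

/-- Banach–Alaoglu handles the norm bound; the other conditions are closed because evaluations are
weak-* continuous. -/
theorem isCompact_ruleFunctionals [IsFiniteMeasure μ] : IsCompact (ruleFunctionals μ l) := by
  have h1 : IsCompact {L : Fin l → WeakDual ℝ (Lp ℝ 2 μ) | ∀ u, L u ∈ WeakDual.toStrongDual ⁻¹'
      Metric.closedBall 0 ‖(memLp_const (μ := μ) (p := 2) (1 : ℝ)).toLp‖} := by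
    have := isCompact_univ_pi (fun _ : Fin l => WeakDual.isCompact_closedBall
      (0 : StrongDual ℝ (Lp ℝ 2 μ)) ‖(memLp_const (μ := μ) (p := 2) (1 : ℝ)).toLp‖)
    convert this using 1
    ext L
    simp
  have hc : ∀ (u : Fin l) (g : Lp ℝ 2 μ),
      Continuous fun L : Fin l → WeakDual ℝ (Lp ℝ 2 μ) => L u g :=
    fun u g => (WeakDual.eval_continuous g).comp (continuous_apply u)
  have h2 : IsClosed {L : Fin l → WeakDual ℝ (Lp ℝ 2 μ) |
      ∀ u, ∀ g : Lp ℝ 2 μ, 0 ≤ g → 0 ≤ L u g} := by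
    simp only [Set.ofPred_forall]
    exact isClosed_iInter fun u => isClosed_iInter fun g => isClosed_iInter fun _ =>
      isClosed_le continuous_const (hc u g)
  have h3 : IsClosed {L : Fin l → WeakDual ℝ (Lp ℝ 2 μ) |
      ∀ g : Lp ℝ 2 μ, ∑ u, L u g = ∫ x, g x ∂μ} := by
    simp only [Set.ofPred_forall]
    exact isClosed_iInter fun g => isClosed_eq (continuous_finsetSum _ fun u _ => hc u g)
      continuous_const
  exact h1.inter_right (h2.inter h3)

/-- The bounded densities lie in `L²`, so message distributions are weak-* continuous evaluations.
Riesz representation identifies the functionals with rules; testing on indicators recovers the a.e.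
constraints. -/
theorem isCompact_ruleSet [IsFiniteMeasure μ] (H : LikelihoodFamily μ h) :
    IsCompact (ruleSet μ h l) := by
  let a : Fin M → Lp ℝ 2 μ := fun m => (H.isTest m).memLp.toLp
  have hev : Continuous fun (L : Fin l → WeakDual ℝ (Lp ℝ 2 μ)) (u : Fin l) (m : Fin M) =>
      L u (a m) :=
    continuous_pi fun u => continuous_pi fun m =>
      (WeakDual.eval_continuous (a m)).comp (continuous_apply u)
  convert isCompact_ruleFunctionals.image hev using 1
  ext q
  constructor
  · rintro ⟨w, hw, rfl⟩
    let W : Fin l → Lp ℝ 2 μ := fun u => (hw.isTest u).memLp.toLp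
    have hW : ∀ u, W u =ᵐ[μ] w u := fun u => MemLp.coeFn_toLp _
    have hval : ∀ u g, InnerProductSpace.toDual ℝ (Lp ℝ 2 μ) (W u) g = ∫ x, w u x * g x ∂μ := by
      intro u g
      rw [InnerProductSpace.toDual_apply_apply, L2_inner_eq_integral_mul]
      exact integral_congr_ae ((hW u).mul (ae_eq_refl _))
    refine ⟨fun u => StrongDual.toWeakDual (InnerProductSpace.toDual ℝ _ (W u)), ⟨?_, ?_, ?_⟩, ?_⟩
    · intro u
      simp only [Set.mem_preimage, mem_closedBall_zero_iff]
      change ‖InnerProductSpace.toDual ℝ (Lp ℝ 2 μ) (W u)‖ ≤ _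
      rw [LinearIsometryEquiv.norm_map]
      refine Lp.norm_le_norm_of_ae_le ?_
      filter_upwards [hW u, (memLp_const (μ := μ) (p := 2) (1 : ℝ)).coeFn_toLp,
        (hw.isTest u).nonneg, (hw.isTest u).le_one] with x h1 h2 h3 h4
      rw [h1, h2, Real.norm_of_nonneg h3, norm_one]
      exact h4
    · intro u g hg
      refine (integral_nonneg_of_ae ?_).trans_eq (hval u g).symm
      filter_upwards [(Lp.coeFn_nonneg g).2 hg, (hw.isTest u).nonneg] with x h1 h2
      exact mul_nonneg h2 h1
    · intro g
      have hg : Integrable g μ := (Lp.memLp g).integrable one_le_two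
      calc _ = ∑ u, ∫ x, w u x * g x ∂μ := Finset.sum_congr rfl fun u _ => hval u g
        _ = ∫ x, ∑ u, w u x * g x ∂μ :=
          (integral_finsetSum _ fun u _ => (hw.isTest u).integrable_mul hg).symm
        _ = _ := integral_congr_ae <| hw.sum_eq_one.mono fun x hx => by
          simp only [← Finset.sum_mul, hx, one_mul]
    · ext u m
      refine (hval u (a m)).trans (integral_congr_ae ?_)
      exact (ae_eq_refl (w u)).mul (MemLp.coeFn_toLp _)
  · rintro ⟨L, ⟨-, hpos, hsum⟩, rfl⟩
    let W : Fin l → Lp ℝ 2 μ := fun u =>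
      (InnerProductSpace.toDual ℝ (Lp ℝ 2 μ)).symm (WeakDual.toStrongDual (L u))
    have hval : ∀ u g, L u g = inner ℝ (W u) g := fun u g =>
      (InnerProductSpace.toDual_symm_apply (𝕜 := ℝ) (E := Lp ℝ 2 μ) (x := g)
        (y := WeakDual.toStrongDual (L u))).symm
    have hint : ∀ u, Integrable (W u) μ := fun u => (Lp.memLp (W u)).integrable one_le_two
    have hset : ∀ u s (hs : MeasurableSet s),
        L u (indicatorConstLp 2 hs (measure_ne_top μ s) (1 : ℝ)) = ∫ x in s, W u x ∂μ := by
      intro u s hs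
      rw [hval, real_inner_comm, L2.inner_indicatorConstLp_one]
    refine ⟨fun u => W u, ⟨fun u => (Lp.stronglyMeasurable (W u)).measurable, ?_, ?_⟩, ?_⟩
    · rw [ae_all_iff]
      intro u
      refine ae_nonneg_of_forall_setIntegral_nonneg (hint u) fun s hs _ => ?_
      rw [← hset u s hs]
      refine hpos u _ ((Lp.coeFn_nonneg _).1 ?_)
      filter_upwards [indicatorConstLp_coeFn (p := 2) (hs := hs) (hμs := measure_ne_top μ s)
        (c := (1 : ℝ))] with x hx
      rw [hx]
      exact Set.indicator_nonneg (fun _ _ => zero_le_one) x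
    · refine Integrable.ae_eq_of_forall_setIntegral_eq _ (fun _ => (1 : ℝ))
        (integrable_finsetSum _ fun u _ => hint u) (integrable_const _) fun s hs _ => ?_
      rw [integral_finsetSum _ fun u _ => (hint u).integrableOn]
      calc ∑ u, ∫ x in s, W u x ∂μ
          = ∑ u, L u (indicatorConstLp 2 hs (measure_ne_top μ s) (1 : ℝ)) :=
            Finset.sum_congr rfl fun u _ => (hset u s hs).symm
        _ = ∫ x, s.indicator (fun _ => (1 : ℝ)) x ∂μ :=
            (hsum _).trans (integral_congr_ae indicatorConstLp_coeFn)
        _ = _ := integral_indicator hs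
    · ext u m
      simp only [ruleVec, hval, L2_inner_eq_integral_mul]
      exact integral_congr_ae ((ae_eq_refl (W u)).mul (MemLp.coeFn_toLp _))

/-- The rule that follows a deterministic quantizer. -/
def detRule (φ : DetQuantizer X l) (u : Fin l) (x : X) : ℝ := if φ.1 x = u then 1 else 0

theorem isRule_detRule (φ : DetQuantizer X l) : IsRule μ (detRule φ) := by
  refine ⟨fun u => ?_, .of_forall fun x u => ?_, .of_forall fun x => ?_⟩
  · exact Measurable.ite (φ.2 (measurableSet_singleton u)) measurable_const measurable_const
  · unfold detRule
    split_ifs <;> norm_num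
  · simp [detRule]

theorem ruleVec_detRule_mem (φ : DetQuantizer X l) :
    ruleVec μ h (detRule φ) ∈ ruleSet μ h l := ⟨_, isRule_detRule φ, rfl⟩

/-- Mass `min (w i) (w j)` can move between messages `i` and `j` in either direction; this is the
perturbation that tests extremality. -/
theorem IsRule.transfer {w : Fin l → X → ℝ} (hw : IsRule μ w) {i j : Fin l} (hij : i ≠ j) {s : ℝ}
    (hs : |s| ≤ 1) : IsRule μ fun u x => w u x +
      s * min (w i x) (w j x) * ((if u = i then 1 else 0) - if u = j then 1 else 0) := by
  obtain ⟨hs1, hs2⟩ := abs_le.1 hs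
  refine ⟨fun u => ?_, ?_, ?_⟩
  · exact (hw.measurable u).add
      ((((hw.measurable i).min (hw.measurable j)).const_mul s).mul_const _)
  · filter_upwards [hw.nonneg] with x hx u
    have h0 : 0 ≤ min (w i x) (w j x) := le_min (hx i) (hx j)
    have h1 := min_le_left (w i x) (w j x)
    have h2 := min_le_right (w i x) (w j x)
    have h3 := hx u
    split_ifs with hu hu' hu'
    · exact (hij (hu ▸ hu')).elim
    · subst hu; nlinarith
    · subst hu'; nlinarith
    · simpa using h3
  · filter_upwards [hw.sum_eq_one] with x hx
    simp [Finset.sum_add_distrib, hx, ← Finset.mul_sum]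

theorem ruleVec_transfer [IsFiniteMeasure μ] (H : LikelihoodFamily μ h) {w : Fin l → X → ℝ}
    (hw : IsRule μ w) (i j : Fin l) (s : ℝ) (u : Fin l) (m : Fin M)
    (ht : IsTest μ fun x => min (w i x) (w j x)) :
    ruleVec μ h (fun u x => w u x +
      s * min (w i x) (w j x) * ((if u = i then 1 else 0) - if u = j then 1 else 0)) u m =
    ruleVec μ h w u m + s * ((if u = i then 1 else 0) - if u = j then 1 else 0) *
      ∫ x, min (w i x) (w j x) * h m x ∂μ := by
  simp only [ruleVec]
  rw [← integral_const_mul, ← integral_add ((hw.isTest u).mul (H.isTest m)).integrable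
    ((ht.mul (H.isTest m)).integrable.const_mul _)]
  exact integral_congr_ae (.of_forall fun x => by simp only; ring)

/-- An extreme message distribution comes from a deterministic quantizer. -/
theorem exists_detRule_of_mem_extremePoints [IsFiniteMeasure μ] (H : LikelihoodFamily μ h)
    (hl : 0 < l) (m : Fin M) {q : Fin l → Fin M → ℝ}
    (hq : q ∈ (ruleSet μ h l).extremePoints ℝ) :
    ∃ φ : DetQuantizer X l, q = ruleVec μ h (detRule φ) := by
  rw [mem_extremePoints] at hq
  obtain ⟨⟨w, hw, rfl⟩, hext⟩ := hq
  have hmin : ∀ i j : Fin l, i ≠ j → ∀ᵐ x ∂μ, min (w i x) (w j x) = 0 := by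
    intro i j hij
    have ht : IsTest μ fun x => min (w i x) (w j x) := by
      refine ⟨(hw.measurable i).min (hw.measurable j), ?_, ?_⟩
      · filter_upwards [hw.nonneg] with x hx using le_min (hx i) (hx j)
      · filter_upwards [(hw.isTest i).le_one] with x hx using (min_le_left _ _).trans hx
    have h1 := fun u k => ruleVec_transfer H hw i j 1 u k ht
    have h2 := fun u k => ruleVec_transfer H hw i j (-1) u k ht
    -- The transfers with `s = 1` and `s = -1` have the given distribution as midpoint, so
    -- extremality makes the transferred mass zero.
    have := (hext _ ⟨_, hw.transfer hij (s := 1) (by simp), rfl⟩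
      _ ⟨_, hw.transfer hij (s := -1) (by simp), rfl⟩
      ⟨1 / 2, 1 / 2, by norm_num, by norm_num, by norm_num, by
        ext u k
        simp only [Pi.add_apply, Pi.smul_apply, h1, h2, smul_eq_mul]
        ring⟩).1
    have h3 := congrFun (congrFun this i) m
    rw [h1] at h3
    have h4 : ∫ x, min (w i x) (w j x) * h m x ∂μ = 0 := by simpa [hij] using h3
    rw [integral_eq_zero_iff_of_nonneg_ae (ht.mul (H.isTest m)).nonneg
      (ht.mul (H.isTest m)).integrable] at h4
    filter_upwards [h4, H.pos m] with x hx hx'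
    simpa [hx'.ne'] using hx
  -- At almost every `x` only one weight is nonzero; `φ` picks the largest.
  obtain ⟨φ, hφ, hφmin⟩ := exists_measurable_argmin hl (g := fun i x => -w i x)
    fun i => (hw.measurable i).neg
  refine ⟨⟨φ, hφ⟩, ?_⟩
  have hae : ∀ᵐ x ∂μ, ∀ u, w u x = detRule ⟨φ, hφ⟩ u x := by
    have hmin' : ∀ᵐ x ∂μ, ∀ i j : Fin l, i ≠ j → min (w i x) (w j x) = 0 :=
      by
      simp only [ae_all_iff]
      exact hmin
    filter_upwards [hmin', hw.sum_eq_one] with x h1 h2 u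
    have h0 : ∀ v, v ≠ φ x → w v x = 0 := fun v hv => by
      rw [← h1 v (φ x) hv, min_eq_left]
      exact neg_le_neg_iff.1 (hφmin x v)
    unfold detRule
    split_ifs with hu
    · simp only at hu
      subst hu
      rw [← h2, Fintype.sum_eq_single (φ x) h0]
    · exact h0 u (Ne.symm hu)
  ext u k
  exact integral_congr_ae (hae.mono fun x hx => by simp only [hx u])

end Rules

/-! ### Divergence vectors of message distributions. -/

section Info

variable {X : Type*} [MeasurableSpace X] {M l : ℕ} {μ : Measure X} {h : Fin M → X → ℝ}

/-- The divergences of hypothesis `m` from the others, as functions of message distributions. -/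
noncomputable def infoVec (m : Fin M) (q : Fin l → Fin M → ℝ) : {m' : Fin M // m' ≠ m} → ℝ :=
  fun m' => ∑ u, klTerm (q u m, q u m'.1)

theorem continuousOn_infoVec [IsFiniteMeasure μ] (H : LikelihoodFamily μ h) (m : Fin M) :
    ContinuousOn (infoVec m) (ruleSet μ h l) := by
  refine continuousOn_pi.2 fun m' => continuousOn_finsetSum _ fun u _ => ?_
  refine (H.continuousOn_klTerm m'.2.symm).comp (f := fun q : Fin l → Fin M → ℝ =>
    (q u m, q u m'.1)) (by fun_prop) ?_
  rintro _ ⟨w, hw, rfl⟩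
  exact ⟨w u, hw.isTest u, rfl⟩

theorem convexOn_infoVec [IsFiniteMeasure μ] (H : LikelihoodFamily μ h) (m : Fin M) :
    ConvexOn ℝ (ruleSet μ h l) (infoVec m) := by
  refine ⟨convex_ruleSet H, ?_⟩
  rintro _ ⟨w, hw, rfl⟩ _ ⟨w', hw', rfl⟩ a b ha hb hab m'
  simp only [infoVec, Pi.add_apply, Pi.smul_apply, smul_eq_mul, Finset.mul_sum,
    ← Finset.sum_add_distrib]
  exact Finset.sum_le_sum fun u _ => convexOn_klTerm.2 (H.mem_massPairs (hw.isTest u) m m'.1)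
    (H.mem_massPairs (hw'.isTest u) m m'.1) ha hb hab

/-- If every rule is a mixture of points of `S`, its information is dominated by a mixture of
informations of points of `S`. -/
theorem exists_dominating_infoVec [IsFiniteMeasure μ] (H : LikelihoodFamily μ h) (m : Fin M)
    {S : Set (Fin l → Fin M → ℝ)} (hS : S ⊆ ruleSet μ h l) (hconv : ruleSet μ h l ⊆ convexHull ℝ S)
    {d : {m' : Fin M // m' ≠ m} → ℝ} (hd : d ∈ infoVec m '' ruleSet μ h l) :
    ∃ z ∈ convexHull ℝ (infoVec m '' S), d ≤ z := by
  obtain ⟨q, hq, rfl⟩ := hd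
  obtain ⟨κ, _, w, z, hw, hw1, hz, rfl⟩ := mem_convexHull_iff_exists_fintype.1 (hconv hq)
  refine ⟨∑ i, w i • infoVec m (z i), ?_, ?_⟩
  · exact (convex_convexHull ℝ _).sum_mem (fun i _ => hw i) hw1
      fun i _ => subset_convexHull ℝ _ ⟨_, hz i, rfl⟩
  · exact (convexOn_infoVec H m).map_sum_le (fun i _ => hw i) hw1 fun i _ => hS (hz i)

end Info

/-! ### Finite and countable mixtures. -/

section Mixtures

variable {α : Type*} {n : ℕ}

/-- The mixture giving mass `w i` to the point `φ i`. -/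
noncomputable def mixture (w : Fin n → ℝ) (hw : ∀ i, 0 ≤ w i) (hw1 : ∑ i, w i = 1)
    (φ : Fin n → α) : PMF α :=
  (PMF.ofFintype (fun i => ENNReal.ofReal (w i)) (by
    rw [← ENNReal.ofReal_sum_of_nonneg fun i _ => hw i, hw1, ENNReal.ofReal_one])).map φ

theorem support_mixture_subset (w : Fin n → ℝ) (hw : ∀ i, 0 ≤ w i) (hw1 : ∑ i, w i = 1)
    (φ : Fin n → α) : (mixture w hw hw1 φ).support ⊆ Set.range φ := by
  rw [mixture, PMF.support_map]
  exact Set.image_subset_range _ _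

theorem encard_support_mixture_le (w : Fin n → ℝ) (hw : ∀ i, 0 ≤ w i) (hw1 : ∑ i, w i = 1)
    (φ : Fin n → α) : (mixture w hw hw1 φ).support.encard ≤ n := by
  refine (Set.encard_le_encard (support_mixture_subset w hw hw1 φ)).trans ?_
  rw [← Set.image_univ]
  exact (Set.encard_image_le _ _).trans (by simp)

theorem tsum_mixture (w : Fin n → ℝ) (hw : ∀ i, 0 ≤ w i) (hw1 : ∑ i, w i = 1)
    (φ : Fin n → α) (g : α → ℝ) :
    ∑' a, (mixture w hw hw1 φ a).toReal * g a = ∑ i, w i * g (φ i) := by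
  classical
  have hval : ∀ a, (mixture w hw hw1 φ a).toReal * g a =
      ∑ i, if a = φ i then w i * g (φ i) else 0 := by
    intro a
    rw [mixture, PMF.map_apply, tsum_fintype, ENNReal.toReal_sum, Finset.sum_mul]
    · refine Finset.sum_congr rfl fun i _ => ?_
      split_ifs with h
      · rw [PMF.ofFintype_apply, ENNReal.toReal_ofReal (hw i), h]
      · simp
    · intro i _
      split_ifs <;> simp
  simp_rw [hval]
  exact (hasSum_sum fun i _ => hasSum_ite_eq (φ i) (w i * g (φ i))).tsum_eq

theorem summable_toReal_smul {E : Type*} [NormedAddCommGroup E] [NormedSpace ℝ E] [CompleteSpace E]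
    (p : PMF α) {v : α → E} {C : ℝ} (hv : ∀ a, ‖v a‖ ≤ C) :
    Summable fun a => (p a).toReal • v a := by
  refine Summable.of_norm_bounded
    ((ENNReal.summable_toReal p.tsum_coe_ne_top).mul_right C) fun a => ?_
  rw [norm_smul, Real.norm_of_nonneg ENNReal.toReal_nonneg]
  exact mul_le_mul_of_nonneg_left (hv a) ENNReal.toReal_nonneg

/-- A countable mixture of points of a closed bounded convex set stays in the set. -/
theorem tsum_toReal_smul_mem {E : Type*} [NormedAddCommGroup E] [NormedSpace ℝ E] [CompleteSpace E]
    (p : PMF α) {v : α → E} {C : ℝ} (hv : ∀ a, ‖v a‖ ≤ C) {s : Set E} (hs : Convex ℝ s)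
    (hsc : IsClosed s) (hvs : ∀ a, v a ∈ s) : ∑' a, (p a).toReal • v a ∈ s := by
  by_contra hx
  -- A separating functional exceeds `u` at every `v a`, hence its average is at least `u`.
  obtain ⟨F, u, h1, h2⟩ := geometric_hahn_banach_point_closed hs hsc hx
  have hsum := summable_toReal_smul p hv
  have hp := ENNReal.summable_toReal p.tsum_coe_ne_top
  rw [F.map_tsum hsum] at h1
  refine h1.not_ge ?_
  calc u = ∑' a, (p a).toReal * u := by
        rw [tsum_mul_right, ← ENNReal.tsum_toReal_eq p.apply_ne_top, p.tsum_coe]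
        simp
    _ ≤ _ := by
        refine (hp.mul_right u).tsum_le_tsum (fun a => ?_) (F.summable hsum)
        rw [map_smul, smul_eq_mul]
        exact mul_le_mul_of_nonneg_left (h2 _ (hvs a)).le ENNReal.toReal_nonneg

end Mixtures

/-! ### Reduction to a finite dominating measure. -/

section TotalLaw

variable {X : Type*} [MeasurableSpace X] {M l : ℕ} {ν : Measure X} {f : Fin M → X → ℝ}

/-- The sum of the laws of an observation under all hypotheses. -/
noncomputable def totalLaw (ν : Measure X) (f : Fin M → X → ℝ) : Measure X :=
  law ν fun x => ∑ m, f m x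

/-- The density of hypothesis `m` relative to `totalLaw`. -/
noncomputable def share (f : Fin M → X → ℝ) (m : Fin M) (x : X) : ℝ := f m x / ∑ k, f k x

theorem measurable_sum_pdf (hf : ∀ m, IsPdf ν (f m)) : Measurable fun x => ∑ m, f m x :=
  Finset.measurable_fun_sum _ fun m _ => (hf m).measurable

theorem measurable_share (hf : ∀ m, IsPdf ν (f m)) (m : Fin M) : Measurable (share f m) :=
  (hf m).measurable.div (measurable_sum_pdf hf)

theorem share_nonneg (hf : ∀ m, IsPdf ν (f m)) (m : Fin M) (x : X) : 0 ≤ share f m x :=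
  div_nonneg ((hf m).nonneg x) (Finset.sum_nonneg fun k _ => (hf k).nonneg x)

theorem law_eq_withDensity_share (hf : ∀ m, IsPdf ν (f m)) (m : Fin M) :
    law ν (f m) = (totalLaw ν f).withDensity fun x => ENNReal.ofReal (share f m x) := by
  rw [totalLaw, law, law, ← withDensity_mul _ (measurable_sum_pdf hf).ennreal_ofReal
    (measurable_share hf m).ennreal_ofReal]
  congr 1
  ext x
  rw [Pi.mul_apply, ← ENNReal.ofReal_mul (Finset.sum_nonneg fun k _ => (hf k).nonneg x), share]
  congr 1
  rcases eq_or_ne (∑ k, f k x) 0 with h0 | h0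
  · rw [(Finset.sum_eq_zero_iff_of_nonneg fun k _ => (hf k).nonneg x).1 h0 m (Finset.mem_univ m)]
    simp
  · rw [mul_div_cancel₀ _ h0]

theorem isFiniteMeasure_totalLaw (hf : ∀ m, IsPdf ν (f m)) : IsFiniteMeasure (totalLaw ν f) := by
  refine ⟨?_⟩
  rw [totalLaw, law, withDensity_apply _ .univ, setLIntegral_univ]
  rw [lintegral_congr fun x => ENNReal.ofReal_sum_of_nonneg fun k _ => (hf k).nonneg x]
  rw [lintegral_finsetSum _ fun m _ => (hf m).measurable.ennreal_ofReal]
  exact ENNReal.sum_lt_top.2 fun m _ => by rw [(hf m).lintegral_eq_one]; exact ENNReal.one_lt_top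

theorem ae_law_iff {g : X → ℝ} (hg : IsPdf ν g) {p : X → Prop} :
    (∀ᵐ x ∂law ν g, p x) ↔ ∀ᵐ x ∂ν, 0 < g x → p x := by
  rw [law, ae_withDensity_iff hg.measurable.ennreal_ofReal]
  simp

theorem ae_totalLaw_iff (hf : ∀ m, IsPdf ν (f m)) {p : X → Prop} :
    (∀ᵐ x ∂totalLaw ν f, p x) ↔ ∀ m, ∀ᵐ x ∂law ν (f m), p x := by
  rw [forall_congr' fun m => ae_law_iff (hf m), ← ae_all_iff]
  rw [totalLaw, law, ae_withDensity_iff (measurable_sum_pdf hf).ennreal_ofReal]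
  refine eventually_congr (.of_forall fun x => ?_)
  rw [ne_eq, ENNReal.ofReal_eq_zero, not_le,
    Finset.sum_pos_iff_of_nonneg fun k _ => (hf k).nonneg x]
  simp

theorem ae_totalLaw_pos (hf : ∀ m, IsPdf ν (f m)) (hKL : FinitePositiveKL ν f) (m : Fin M) :
    ∀ᵐ x ∂totalLaw ν f, 0 < f m x := by
  rw [ae_totalLaw_iff hf]
  intro k
  rcases eq_or_ne k m with rfl | hkm
  · exact (ae_law_iff (hf k)).2 (.of_forall fun x hx => hx)
  · exact (hKL k m hkm).1

/-- `ν` is arbitrary, whereas `totalLaw` is finite and its densities are bounded by one. The common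
denominator cancels in likelihood ratios. -/
theorem likelihoodFamily_share (hf : ∀ m, IsPdf ν (f m)) (hKL : FinitePositiveKL ν f) (m₀ : Fin M) :
    LikelihoodFamily (totalLaw ν f) (share f) := by
  have hsum : ∀ x, 0 < f m₀ x → 0 < ∑ k, f k x := fun x hx =>
    Finset.sum_pos' (fun k _ => (hf k).nonneg x) ⟨m₀, Finset.mem_univ _, hx⟩
  refine ⟨measurable_share hf, fun m => ?_, ?_, fun m m' hm => ?_⟩
  · filter_upwards [ae_totalLaw_pos hf hKL m, ae_totalLaw_pos hf hKL m₀] with x h1 h2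
    exact div_pos h1 (hsum x h2)
  · filter_upwards [ae_totalLaw_pos hf hKL m₀] with x hx
    simp only [share]
    rw [← Finset.sum_div, div_self (hsum x hx).ne']
  · have h1 := (hKL m m' hm).2.1
    rw [law_eq_withDensity_share hf m, integrable_withDensity_iff_integrable_smul'
      (measurable_share hf m).ennreal_ofReal (.of_forall fun x => ENNReal.ofReal_lt_top)] at h1
    refine h1.congr ?_
    filter_upwards [ae_totalLaw_pos hf hKL m₀] with x hx
    rw [ENNReal.toReal_ofReal (share_nonneg hf m x), smul_eq_mul, share, share,
      div_div_div_cancel_right₀ (hsum x hx).ne']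

theorem msgProb_eq_ruleVec (hf : ∀ m, IsPdf ν (f m)) (φ : DetQuantizer X l) (u : Fin l)
    (m : Fin M) : msgProb ν (f m) φ u = ruleVec (totalLaw ν f) (share f) (detRule φ) u m := by
  have hA : MeasurableSet {x | φ.1 x = u} := φ.2 (measurableSet_singleton u)
  rw [msgProb, ← integral_indicator_one hA, law_eq_withDensity_share hf m,
    integral_withDensity_eq_integral_toReal_smul (measurable_share hf m).ennreal_ofReal
      (.of_forall fun x => ENNReal.ofReal_lt_top), ruleVec]
  refine integral_congr_ae (.of_forall fun x => ?_)
  simp only [ENNReal.toReal_ofReal (share_nonneg hf m x), smul_eq_mul, detRule,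
    Set.indicator_apply, Set.mem_ofPred_eq, Pi.one_apply]
  rw [mul_comm]

theorem detInfo_eq_infoVec (hf : ∀ m, IsPdf ν (f m)) (φ : DetQuantizer X l) (m : Fin M)
    (m' : {m' : Fin M // m' ≠ m}) : detInfo ν f m m'.1 φ =
      infoVec m (ruleVec (totalLaw ν f) (share f) (detRule φ)) m' := by
  simp only [detInfo, infoVec, klTerm, msgProb_eq_ruleVec hf]

end TotalLaw

/-! ### Linear costs and generic absence of ties. -/

section Likelihood

variable {X : Type*} [MeasurableSpace X] {M l : ℕ} {μ : Measure X} {h : Fin M → X → ℝ}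

/-- The value of the linear functional with coefficients `a` at the message distributions `q`. -/
def pairing (a q : Fin l → Fin M → ℝ) : ℝ := ∑ u, ∑ m, a u m * q u m

theorem continuous_pairing :
    Continuous fun p : (Fin l → Fin M → ℝ) × (Fin l → Fin M → ℝ) => pairing p.1 p.2 := by
  unfold pairing
  fun_prop

theorem exists_eq_pairing (F : StrongDual ℝ (Fin l → Fin M → ℝ)) :
    ∃ a, ∀ q, F q = pairing a q := by
  classical
  refine ⟨fun u m => F (Pi.single u (Pi.single m 1)), fun q => ?_⟩
  have hq : q = ∑ u, ∑ m, q u m • (Pi.single u (Pi.single m 1) : Fin l → Fin M → ℝ) := by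
    ext u m
    simp only [Finset.sum_apply, Pi.smul_apply, smul_eq_mul]
    rw [Finset.sum_eq_single u, Finset.sum_eq_single m] <;>
      simp +contextual [Pi.single_apply, eq_comm]
  conv_lhs => rw [hq]
  simp only [map_sum, map_smul, smul_eq_mul, pairing]
  exact Finset.sum_congr rfl fun u _ => Finset.sum_congr rfl fun m _ => mul_comm _ _

theorem IsRule.integrable_cost [IsFiniteMeasure μ] (H : LikelihoodFamily μ h)
    {w : Fin l → X → ℝ} (hw : IsRule μ w) (a : Fin l → Fin M → ℝ) :
    Integrable (fun x => ∑ u, w u x * ∑ m, a u m * h m x) μ :=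
  integrable_finsetSum _ fun u _ => (hw.isTest u).integrable_mul <|
    integrable_finsetSum _ fun m _ => (H.isTest m).integrable.const_mul _

theorem pairing_ruleVec [IsFiniteMeasure μ] (H : LikelihoodFamily μ h)
    {w : Fin l → X → ℝ} (hw : IsRule μ w) (a : Fin l → Fin M → ℝ) :
    pairing a (ruleVec μ h w) = ∫ x, ∑ u, w u x * ∑ m, a u m * h m x ∂μ := by
  have I := fun u m => ((hw.isTest u).mul (H.isTest m)).integrable.const_mul (a u m)
  simp only [pairing, ruleVec, ← integral_const_mul]
  rw [← Finset.sum_congr rfl fun u _ => integral_finsetSum _ fun m _ => I u m,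
    ← integral_finsetSum _ fun u _ => integrable_finsetSum _ fun m _ => I u m]
  refine integral_congr_ae (.of_forall fun x => Finset.sum_congr rfl fun u _ => ?_)
  rw [Finset.mul_sum]
  exact Finset.sum_congr rfl fun m _ => by ring

/-- A quantizer that minimizes the cost pointwise minimizes it among all rules. -/
theorem pairing_detRule_le [IsFiniteMeasure μ] (H : LikelihoodFamily μ h)
    {a : Fin l → Fin M → ℝ} {φ : DetQuantizer X l} (hφ : ∀ x, IsArgmin h a x (φ.1 x))
    {q : Fin l → Fin M → ℝ} (hq : q ∈ ruleSet μ h l) :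
    pairing a (ruleVec μ h (detRule φ)) ≤ pairing a q := by
  obtain ⟨w, hw, rfl⟩ := hq
  rw [pairing_ruleVec H (isRule_detRule φ), pairing_ruleVec H hw]
  refine integral_mono_ae ((isRule_detRule φ).integrable_cost H a) (hw.integrable_cost H a) ?_
  filter_upwards [hw.nonneg, hw.sum_eq_one] with x h1 h2
  calc ∑ u, detRule φ u x * ∑ m, a u m * h m x = ∑ m, a (φ.1 x) m * h m x := by simp [detRule]
    _ = ∑ u, w u x * ∑ m, a (φ.1 x) m * h m x := by rw [← Finset.sum_mul, h2, one_mul]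
    _ ≤ _ := Finset.sum_le_sum fun u _ => mul_le_mul_of_nonneg_left (hφ x u) (h1 u)

/-- Almost all coefficients produce ties with probability zero. -/
theorem dense_separating [SFinite μ] {f : Fin M → X → ℝ} (hf : ∀ m, Measurable (f m)) (m₀ : Fin M)
    (hpos : ∀ᵐ x ∂μ, 0 < f m₀ x) (l : ℕ) :
    Dense {a : Fin l → Fin M → ℝ | ∀ᵐ x ∂μ, ∀ i j : Fin l, i ≠ j →
      ∑ m, a i m * f m x ≠ ∑ m, a j m * f m x} := by
  classical
  refine Measure.dense_of_ae (μ := volume) ?_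
  have hmeas : ∀ i : Fin l, Measurable fun p : (Fin l → Fin M → ℝ) × X =>
      ∑ m, p.1 i m * f m p.2 := fun i =>
    Finset.measurable_fun_sum _ fun m _ => Measurable.mul (by fun_prop) ((hf m).comp measurable_snd)
  -- Fubini: for fixed `x` with `f m₀ x > 0`, the tying coefficients of `i` and `j` form a proper
  -- subspace, which is Lebesgue null.
  rw [Measure.ae_ae_comm]
  · filter_upwards [hpos] with x hx
    simp only [ae_all_iff]
    intro i j hij
    let T : (Fin l → Fin M → ℝ) →ₗ[ℝ] ℝ :=
      ∑ m, f m x • ((LinearMap.proj m : (Fin M → ℝ) →ₗ[ℝ] ℝ) ∘ₗ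
        ((LinearMap.proj i : (Fin l → Fin M → ℝ) →ₗ[ℝ] Fin M → ℝ) - LinearMap.proj j))
    have hT : ∀ a, T a = ∑ m, a i m * f m x - ∑ m, a j m * f m x := by
      intro a
      rw [← Finset.sum_sub_distrib]
      simp only [T, LinearMap.sum_apply, LinearMap.smul_apply, LinearMap.comp_apply,
        LinearMap.sub_apply, LinearMap.proj_apply, Pi.sub_apply, smul_eq_mul]
      exact Finset.sum_congr rfl fun m _ => by ring
    have hne : LinearMap.ker T ≠ ⊤ := by
      intro htop
      have h1 : T (Pi.single i (Pi.single m₀ 1)) = 0 := by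
        rw [LinearMap.ker_eq_top.1 htop, LinearMap.zero_apply]
      rw [hT, Pi.single_eq_same, Pi.single_eq_of_ne hij.symm] at h1
      simp [Pi.single_apply, hx.ne'] at h1
    refine measure_mono_null (fun a ha => ?_) (Measure.addHaar_submodule volume _ hne)
    have ha' : ∑ m, a i m * f m x = ∑ m, a j m * f m x := by simpa using ha
    change T a = 0
    rw [hT, ha', sub_self]
  · simp only [Set.ofPred_forall]
    exact MeasurableSet.iInter fun i => MeasurableSet.iInter fun j => MeasurableSet.iInter fun _ =>
      (measurableSet_eq_fun (hmeas i) (hmeas j)).compl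

end Likelihood

/-! ### ULQ limits generate all rules. -/

section ULQ

variable {X : Type*} [MeasurableSpace X] {M l : ℕ} {ν : Measure X} {f : Fin M → X → ℝ}

/-- The message distributions of unambiguous likelihood quantizers. -/
def ulqSet (ν : Measure X) (f : Fin M → X → ℝ) (l : ℕ) : Set (Fin l → Fin M → ℝ) :=
  {q | ∃ φ : DetQuantizer X l, IsULQ ν f φ ∧ q = ruleVec (totalLaw ν f) (share f) (detRule φ)}

theorem ulqSet_subset : ulqSet ν f l ⊆ ruleSet (totalLaw ν f) (share f) l := by
  rintro _ ⟨φ, -, rfl⟩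
  exact ruleVec_detRule_mem φ

theorem IsArgmin.share (hf : ∀ m, IsPdf ν (f m)) {a : Fin l → Fin M → ℝ} {x : X} {i : Fin l}
    (h : IsArgmin f a x i) : IsArgmin (share f) a x i := by
  intro j
  simp only [Decentralized.share, ← mul_div_assoc, ← Finset.sum_div]
  exact div_le_div_of_nonneg_right (h j) (Finset.sum_nonneg fun k _ => (hf k).nonneg x)

theorem exists_isULQ_argmin (hf : ∀ m, IsPdf ν (f m)) (hl : 0 < l) {a : Fin l → Fin M → ℝ}
    (ha : ∀ᵐ x ∂totalLaw ν f, ∀ i j : Fin l, i ≠ j →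
      ∑ m, a i m * f m x ≠ ∑ m, a j m * f m x) :
    ∃ φ : DetQuantizer X l, IsULQ ν f φ ∧ ∀ x, IsArgmin f a x (φ.1 x) := by
  obtain ⟨φ, hφ, hmin⟩ := exists_measurable_argmin hl (g := fun i x => ∑ m, a i m * f m x)
    fun i => Finset.measurable_fun_sum _ fun m _ => (hf m).measurable.const_mul _
  refine ⟨⟨φ, hφ⟩, ⟨a, hmin, fun m => ?_⟩, hmin⟩
  rw [measure_eq_zero_iff_ae_notMem]
  filter_upwards [(ae_totalLaw_iff hf).1 ha m] with x hx
  rintro ⟨i, j, hij, hi, hj⟩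
  exact hx i j hij ((hi j).antisymm (hj i))

/-- Every message distribution is a mixture of limits of those of ULQs. -/
theorem ruleSet_subset_convexHull_closure_ulqSet (hf : ∀ m, IsPdf ν (f m))
    (hKL : FinitePositiveKL ν f) (hl : 0 < l) (m₀ : Fin M) :
    ruleSet (totalLaw ν f) (share f) l ⊆ convexHull ℝ (closure (ulqSet ν f l)) := by
  have := isFiniteMeasure_totalLaw hf
  have H := likelihoodFamily_share hf hKL m₀
  have hcpt : IsCompact (ruleSet (totalLaw ν f) (share f) l) := isCompact_ruleSet H
  have hcl : IsCompact (closure (ulqSet ν f l)) :=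
    hcpt.of_isClosed_subset isClosed_closure (closure_minimal ulqSet_subset hcpt.isClosed)
  intro q hq
  by_contra hq'
  obtain ⟨F, c, hFq, hF⟩ := geometric_hahn_banach_point_closed (convex_convexHull ℝ _)
    (isCompact_convexHull hcl).isClosed hq'
  obtain ⟨a, ha⟩ := exists_eq_pairing F
  -- The separating cost `a` may have ties. Tie-free costs `A k → a` are minimized by ULQs, and a
  -- subsequential limit `s` of their distributions minimizes `a`, contradicting the separation.
  obtain ⟨A, hA, hAlim⟩ := mem_closure_iff_seq_limit.1
    (dense_separating (fun m => (hf m).measurable) m₀ (ae_totalLaw_pos hf hKL m₀) l a)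
  choose φ hφ hφmin using fun k => exists_isULQ_argmin hf hl (hA k)
  obtain ⟨s, -, ψ, hψ, hs⟩ := hcpt.tendsto_subseq fun k => ruleVec_detRule_mem (φ k)
  have hscl : s ∈ closure (ulqSet ν f l) :=
    mem_closure_of_tendsto hs (.of_forall fun k => ⟨_, hφ _, rfl⟩)
  have hle : pairing a s ≤ pairing a q := by
    have hA' := hAlim.comp hψ.tendsto_atTop
    refine le_of_tendsto_of_tendsto'
      ((continuous_pairing.tendsto (a, s)).comp (hA'.prodMk_nhds hs))
      ((continuous_pairing.tendsto (a, q)).comp (hA'.prodMk_nhds tendsto_const_nhds)) fun k => ?_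
    exact pairing_detRule_le H (fun x => (hφmin _ x).share hf) hq
  rw [← ha, ← ha] at hle
  linarith [hF s (subset_convexHull ℝ _ hscl)]

end ULQ

/-! ### Information of general quantizers. -/

section Quantizers

variable {X : Type*} [MeasurableSpace X] {M l : ℕ} {ν : Measure X} {f : Fin M → X → ℝ}

theorem info_mixture (hf : ∀ m, IsPdf ν (f m)) (m : Fin M) {n : ℕ} (w : Fin n → ℝ)
    (hw : ∀ i, 0 ≤ w i) (hw1 : ∑ i, w i = 1) (φ : Fin n → DetQuantizer X l) :
    info ν f m (mixture w hw hw1 φ) =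
      ⨅ m', (∑ i, w i • infoVec m (ruleVec (totalLaw ν f) (share f) (detRule (φ i)))) m' := by
  unfold info pairInfo
  congr 1
  ext m'
  rw [tsum_mixture]
  simp [detInfo_eq_infoVec hf]

theorem exists_infoVec_bound (hf : ∀ m, IsPdf ν (f m)) (hKL : FinitePositiveKL ν f) (m : Fin M)
    (l : ℕ) : ∃ C, ∀ φ : DetQuantizer X l,
      ‖infoVec m (ruleVec (totalLaw ν f) (share f) (detRule φ))‖ ≤ C := by
  have := isFiniteMeasure_totalLaw hf
  have H := likelihoodFamily_share hf hKL m
  obtain ⟨C, hC⟩ :=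
    ((isCompact_ruleSet H (l := l)).image_of_continuousOn
      (continuousOn_infoVec H m)).isBounded.exists_norm_le
  exact ⟨C, fun φ => hC _ ⟨_, ruleVec_detRule_mem φ, rfl⟩⟩

theorem summable_smul_infoVec (hf : ∀ m, IsPdf ν (f m)) (hKL : FinitePositiveKL ν f)
    (q : Quantizer X l) (m : Fin M) : Summable fun φ =>
      (q φ).toReal • infoVec m (ruleVec (totalLaw ν f) (share f) (detRule φ)) := by
  obtain ⟨C, hC⟩ := exists_infoVec_bound hf hKL m l
  have h0 := summable_toReal_smul q hC
  exact h0

theorem summable_detInfo (hf : ∀ m, IsPdf ν (f m)) (hKL : FinitePositiveKL ν f) (q : Quantizer X l)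
    {m m' : Fin M} (hm : m' ≠ m) : Summable fun φ => (q φ).toReal * detInfo ν f m m' φ := by
  have h0 := summable_smul_infoVec hf hKL q m
  have h1 := Pi.summable.1 h0 ⟨m', hm⟩
  refine h1.congr fun φ => ?_
  have h2 := detInfo_eq_infoVec hf φ m ⟨m', hm⟩
  simp only at h2
  rw [h2, Pi.smul_apply, smul_eq_mul]

theorem pairInfo_eq_tsum (hf : ∀ m, IsPdf ν (f m)) (hKL : FinitePositiveKL ν f) (m : Fin M)
    (q : Quantizer X l) : (fun m' : {m' : Fin M // m' ≠ m} => pairInfo ν f m m'.1 q) =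
      ∑' φ, (q φ).toReal • infoVec m (ruleVec (totalLaw ν f) (share f) (detRule φ)) := by
  have h0 := summable_smul_infoVec hf hKL q m
  ext m'
  rw [tsum_apply h0, pairInfo]
  refine tsum_congr fun φ => ?_
  rw [detInfo_eq_infoVec hf φ m m', Pi.smul_apply, smul_eq_mul]

theorem pairInfo_mem_convexHull (hf : ∀ m, IsPdf ν (f m)) (hKL : FinitePositiveKL ν f)
    (m : Fin M) (q : Quantizer X l) :
    (fun m' : {m' : Fin M // m' ≠ m} => pairInfo ν f m m'.1 q) ∈
      convexHull ℝ (infoVec m '' ruleSet (totalLaw ν f) (share f) l) := by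
  have := isFiniteMeasure_totalLaw hf
  have H := likelihoodFamily_share hf hKL m
  obtain ⟨C, hC⟩ := exists_infoVec_bound hf hKL m l
  have hcl := (isCompact_convexHull ((isCompact_ruleSet H (l := l)).image_of_continuousOn
    (continuousOn_infoVec H m))).isClosed
  have hmem : ∀ φ : DetQuantizer X l, infoVec m (ruleVec (totalLaw ν f) (share f) (detRule φ)) ∈
      convexHull ℝ (infoVec m '' ruleSet (totalLaw ν f) (share f) l) :=
    fun φ => subset_convexHull ℝ _ ⟨_, ruleVec_detRule_mem φ, rfl⟩
  rw [pairInfo_eq_tsum hf hKL]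
  exact tsum_toReal_smul_mem q hC (convex_convexHull ℝ _) hcl hmem

end Quantizers

end Decentralized

/-! ### The maximin theorem. -/

open Decentralized in
theorem theorem5p1 {X : Type*} [MeasurableSpace X] (ν : Measure X) (M l : ℕ) (hM : 2 ≤ M)
    (hl : 2 ≤ l) (f : Fin M → X → ℝ) (hf : ∀ m, Decentralized.IsPdf ν (f m))
    (hKL : Decentralized.FinitePositiveKL ν f) (m : Fin M) :
    (∀ (q : Decentralized.Quantizer X l) (m' : Fin M), m' ≠ m →
      Summable fun φ => (q φ).toReal * Decentralized.detInfo ν f m m' φ) ∧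
    (∃ q : Decentralized.Quantizer X l,
      Decentralized.IsMaximin ν f m q ∧ q.support.encard ≤ ((M - 1 : ℕ) : ℕ∞)) ∧
    (∃ q : ℕ → Decentralized.Quantizer X l,
      (∀ i, (q i).support.encard ≤ ((M - 1 : ℕ) : ℕ∞) ∧
        ∀ φ ∈ (q i).support, Decentralized.IsULQ ν f φ) ∧
      Tendsto (fun i => Decentralized.info ν f m (q i)) atTop
        (𝓝 (Decentralized.maximinInfo ν f l m))) := by
  have hl0 : 0 < l := by omega
  have hfin := isFiniteMeasure_totalLaw hf
  have H := likelihoodFamily_share hf hKL m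
  have hcpt : IsCompact (ruleSet (totalLaw ν f) (share f) l) := isCompact_ruleSet H
  have hcard : Fintype.card {m' : Fin M // m' ≠ m} = M - 1 := by simp
  have : Nonempty {m' : Fin M // m' ≠ m} := Fintype.card_pos_iff.1 (by omega)
  have hD := hcpt.image_of_continuousOn (continuousOn_infoVec H m)
  have hDne : (infoVec m '' ruleSet (totalLaw ν f) (share f) l).Nonempty :=
    ⟨_, _, ruleVec_detRule_mem ⟨fun _ => ⟨0, hl0⟩, measurable_const⟩, rfl⟩
  have hSsub : closure (ulqSet ν f l) ⊆ ruleSet (totalLaw ν f) (share f) l :=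
    closure_minimal ulqSet_subset hcpt.isClosed
  obtain ⟨n, z, w, hn, hz, hw, hw1, hmax⟩ := exists_maximin_combination hD hDne
    (Set.image_mono extremePoints_subset) fun d => exists_dominating_infoVec H m
      extremePoints_subset (convexHull_extremePoints_eq hcpt (convex_ruleSet H)).ge
  obtain ⟨n', z', w', hn', hz', hw', hw1', hmax'⟩ := exists_maximin_combination hD hDne
    (Set.image_mono hSsub) fun d => exists_dominating_infoVec H m hSsub
      (ruleSet_subset_convexHull_closure_ulqSet hf hKL hl0 m)
  rw [hcard] at hn hn'
  choose e he hez using hz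
  choose φ hφ using fun i => exists_detRule_of_mem_extremePoints H hl0 m (he i)
  have hinfo : info ν f m (mixture w hw hw1 φ) = ⨅ m', (∑ i, w i • z i) m' := by
    rw [info_mixture hf]
    simp_rw [← hφ, hez]
  have hmaximin : IsMaximin ν f m (mixture w hw hw1 φ) := fun q =>
    (hmax _ (pairInfo_mem_convexHull hf hKL m q)).trans_eq hinfo.symm
  refine ⟨fun q m' hm => summable_detInfo hf hKL q hm,
    ⟨_, hmaximin, (encard_support_mixture_le ..).trans (by exact_mod_cast hn)⟩, ?_⟩
  -- Both combinations maximize over the same hull, so the one built from ULQ limits also has value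
  -- `I(m)`.
  have hvalue : maximinInfo ν f l m = ⨅ m', (∑ i, w' i • z' i) m' := by
    have : Nonempty (Quantizer X l) := ⟨mixture w hw hw1 φ⟩
    have h1 : maximinInfo ν f l m = info ν f m (mixture w hw hw1 φ) :=
      (ciSup_le hmaximin).antisymm (le_ciSup ⟨_, Set.forall_mem_range.2 hmaximin⟩ _)
    rw [h1]
    refine (hmax' _ (pairInfo_mem_convexHull hf hKL m _)).antisymm (le_trans ?_ hinfo.ge)
    exact hmax _ ((convex_convexHull ℝ _).sum_mem (fun i _ => hw' i) hw1'
      fun i _ => subset_convexHull ℝ _ (Set.image_mono hSsub (hz' i)))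
  choose s hs hsz using hz'
  choose σ hσ hσlim using fun i => mem_closure_iff_seq_limit.1 (hs i)
  choose φ' hφ' hσφ using hσ
  refine ⟨fun k => mixture w' hw' hw1' fun i => φ' i k, fun k => ⟨?_, fun ψ hψ => ?_⟩, ?_⟩
  · exact (encard_support_mixture_le ..).trans (by exact_mod_cast hn')
  · obtain ⟨i, rfl⟩ := support_mixture_subset _ _ _ _ hψ
    exact hφ' i k
  · rw [hvalue]
    simp_rw [info_mixture hf, ← hσφ]
    refine tendsto_iInf_apply (tendsto_finsetSum _ fun i _ => Tendsto.const_smul ?_ _)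
    rw [← hsz]
    exact (continuousOn_infoVec H m _ (hSsub (hs i))).tendsto.comp
      (tendsto_nhdsWithin_iff.2 ⟨hσlim i, .of_forall fun k =>
        hSsub (subset_closure ⟨_, hφ' i k, hσφ i k⟩)⟩)
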